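/- Let $q\colon X\to Q$ be an open map of locales, i.e. $q^{-1}\colon \mathcal{O}Q\to\mathcal{O}X$ has a left adjoint $q_!$ satisfying Frobenius reciprocity $q_!(U\wedge q^{-1}(V))=q_!(U)\wedge V$. A localic relation on $X$ is a sublocale $r\colon R\rightarrowtail X\times X$, with source and target maps $s=\mathrm{pr}_1\circ r$ and $t=\mathrm{pr}_2\circ r$. It has open cones if $s$ and $t$ are open; its cones are then $\Uparrow_R:=t_!s^{-1}$ and $\Downarrow_R:=s_!t^{-1}$. For functions $u,d\colon\mathcal{O}X\to\mathcal{O}X$ let $R_{u,d}$ be the localic relation on $X$ whose frame is the quotient of $\mathcal{O}X\otimes\mathcal{O}X$ by the frame congruence generated by the relation $\sim$ on rectangles given by $a\otimes b\sim c\otimes d'$ if $u(a)\wedge b=u(c)\wedge d'$ and $a\wedge d(b)=c\wedge d(d')$. Let $\mathsf{Cone}\dashv\mathsf{Rel}$ be the adjunction between - the category of locales with an open cone relation $(X,R)$, whose morphisms $(X,R)\to(Y,S)$ are the locale maps $f\colon X\to Y$ such that $f\times f$ restricts to a map $R\to S$, and - the opposite of the category of conic frames $(L,u,d)$, that is, frames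 $L$ with join-preserving functions $u,d\colon L\to L$ satisfying $u(x)\wedge y\le u(x\wedge d(y))$ and $x\wedge d(y)\le d(u(x)\wedge y)$, whose morphisms $(L,u,d)\to(L',u',d')$ are the frame maps $h\colon L\to L'$ with $u'h\le hu$ and $d'h\le hd$, where $\mathsf{Cone}(X,R)=(\mathcal{O}X,\Uparrow_R,\Downarrow_R)$ and $\mathsf{Rel}(\mathcal{O}X,u,d)=(X,R_{u,d})$, and both functors act on morphisms by $f\leftrightarrow f^{-1}$. The unit at $(X,R)$ is carried by $\mathrm{id}_X$. Then the kernel pair $K:=X\times_Q X\rightarrowtail X\times X$ has open cones, and $\Uparrow_K=\Downarrow_K=q^{-1}q_!$. Moreover, $(X,K)$ is a fixed point of the adjunction $\mathsf{Cone}\dashv\mathsf{Rel}$, meaning that the unit at $(X,K)$ is an isomorphism; equivalently, $K$ and $R_{\Uparrow_K,\Downarrow_K}$ are the same sublocale of $X\times X$. -/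

import Mathlib

open CategoryTheory

universe u

namespace Localic

/-! ## Sublocales generated by a binary relation -/

section Saturated

variable {L M : Type*} [Order.Frame L] [Order.Frame M]

/-- The sublocale `L/∼` of saturated elements of a binary relation `∼` on a frame. -/
def saturated (r : L → L → Prop) : Sublocale L where
  carrier := {s | ∀ a b c, r a b → (a ⊓ c ≤ s ↔ b ⊓ c ≤ s)}
  sInf_mem' S hS a b c hab := by
    simp only [le_sInf_iff]
    exact forall₂_congr fun s hs => hS hs a b c hab
  himp_mem' x s hs a b c hab := by
    simp only [le_himp_iff, inf_assoc]
    exact hs a b (c ⊓ x) hab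

theorem mem_saturated {r : L → L → Prop} {s : L} :
    s ∈ saturated r ↔ ∀ a b c, r a b → (a ⊓ c ≤ s ↔ b ⊓ c ≤ s) := Iff.rfl

theorem restrict_le_iff (S : Sublocale L) (x : L) (s : S) : S.restrict x ≤ s ↔ x ≤ (s : L) :=
  S.giRestrict.gc x s

theorem restrict_coe (S : Sublocale L) (s : S) : S.restrict (s : L) = s :=
  S.giRestrict.l_u_eq s

/-- The quotient map identifies related elements. -/
theorem restrict_saturated_eq {r : L → L → Prop} {a b : L} (h : r a b) :
    (saturated r).restrict a = (saturated r).restrict b := by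
  refine eq_of_forall_ge_iff fun s => ?_
  rw [restrict_le_iff, restrict_le_iff]
  simpa using s.2 a b ⊤ h

/-- A frame map that does not distinguish `x` from its closure factors through a sublocale. -/
def factor (S : Sublocale L) (h : FrameHom L M) (hS : ∀ x, h (S.restrict x : L) = h x) :
    FrameHom S M where
  toFun s := h s
  map_inf' a b := by simp
  map_top' := map_top h
  map_sSup' T := by
    have : sSup T = S.restrict (sSup ((fun s : S => (s : L)) '' T)) := by
      rw [map_sSup, Set.image_image]
      simp
    rw [this, hS, map_sSup, Set.image_image]

theorem factor_restrict (S : Sublocale L) (h : FrameHom L M)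
    (hS : ∀ x, h (S.restrict x : L) = h x) : (factor S h hS).comp S.restrict = h := by
  ext x
  exact hS x

theorem apply_restrict_saturated (r : L → L → Prop) (h : FrameHom L M)
    (hr : ∀ a b, r a b → h a = h b) (x : L) : h ((saturated r).restrict x : L) = h x := by
  have gc : GaloisConnection h (fun y => sSup {x | h x ≤ y}) := by
    intro x y
    refine ⟨fun hx => le_sSup hx, fun hx => (OrderHomClass.mono h hx).trans ?_⟩
    rw [map_sSup]
    exact sSup_le (by rintro _ ⟨z, hz, rfl⟩; exact hz)
  refine le_antisymm ?_ (OrderHomClass.mono h ?_)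
  · have hm : sSup {z | h z ≤ h x} ∈ saturated r := by
      intro a b c hab
      rw [← gc, ← gc, map_inf, map_inf, hr a b hab]
    have := (restrict_le_iff (saturated r) x ⟨_, hm⟩).2 ((gc _ _).1 le_rfl)
    exact (gc _ _).2 this
  · exact (restrict_le_iff _ _ _).1 le_rfl

theorem restrict_hom_ext (S : Sublocale L) {f g : FrameHom S M}
    (h : ∀ x, f (S.restrict x) = g (S.restrict x)) : f = g := by
  ext s
  simpa [restrict_coe] using h s

end Saturated

/-! ## Binary coproducts of frames -/

section Coprod

variable {L M N : Type*} [Order.Frame L] [Order.Frame M] [Order.Frame N]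

/-- The lower sets of `L × M` that are closed under joins in each coordinate. -/
def coprodSublocale (L M : Type*) [Order.Frame L] [Order.Frame M] :
    Sublocale (LowerSet (L × M)) where
  carrier := {D | (∀ (S : Set L) (y : M), (∀ x ∈ S, (x, y) ∈ D) → (sSup S, y) ∈ D) ∧
    ∀ (x : L) (S : Set M), (∀ y ∈ S, (x, y) ∈ D) → (x, sSup S) ∈ D}
  sInf_mem' T hT := by
    constructor
    · intro S y h
      simp only [LowerSet.mem_sInf_iff] at h ⊢
      exact fun D hD => (hT hD).1 S y fun x hx => h x hx D hD
    · intro x S h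
      simp only [LowerSet.mem_sInf_iff] at h ⊢
      exact fun D hD => (hT hD).2 x S fun y hy => h y hy D hD
  himp_mem' A D hD := by
    have key : ∀ p : L × M, p ∈ A ⇨ D ↔ ∀ q ≤ p, q ∈ A → q ∈ D := by
      intro p
      rw [← LowerSet.Iic_le, le_himp_iff]
      exact ⟨fun h q hq hA => h ⟨hq, hA⟩, fun h q hq => h q hq.1 hq.2⟩
    constructor
    · intro S y h
      rw [key]
      rintro ⟨a, b⟩ ⟨ha, hb⟩ hA
      have hab : a = sSup ((fun x => a ⊓ x) '' S) := by
        rw [sSup_image, ← inf_sSup_eq]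
        exact (inf_eq_left.2 ha).symm
      rw [hab]
      refine hD.1 _ _ ?_
      rintro _ ⟨x, hx, rfl⟩
      exact (key _).1 (h x hx) _ ⟨inf_le_right, hb⟩ 
        (A.lower (show (a ⊓ x, b) ≤ (a, b) from ⟨inf_le_left, le_rfl⟩) hA)
    · intro x S h
      rw [key]
      rintro ⟨a, b⟩ ⟨ha, hb⟩ hA
      have hab : b = sSup ((fun y => b ⊓ y) '' S) := by
        rw [sSup_image, ← inf_sSup_eq]
        exact (inf_eq_left.2 hb).symm
      rw [hab]
      refine hD.2 _ _ ?_
      rintro _ ⟨y, hy, rfl⟩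
      exact (key _).1 (h y hy) _ ⟨ha, inf_le_right⟩ 
        (A.lower (show (a, b ⊓ y) ≤ (a, b) from ⟨le_rfl, inf_le_left⟩) hA)

/-- The coproduct `L ⊗ M` of two frames. -/
abbrev FrameCoprod (L M : Type*) [Order.Frame L] [Order.Frame M] : Type _ :=
  ↥(coprodSublocale L M)

/-- The basic rectangle `x ⊗ y`. -/
def rect (x : L) (y : M) : FrameCoprod L M :=
  (coprodSublocale L M).restrict (LowerSet.Iic (x, y))

theorem rect_le_iff {x : L} {y : M} {D : FrameCoprod L M} :
    rect x y ≤ D ↔ (x, y) ∈ (D : LowerSet (L × M)) := by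
  rw [rect, restrict_le_iff, LowerSet.Iic_le]

theorem eq_sSup_rect (D : FrameCoprod L M) :
    D = sSup ((fun p : L × M => rect p.1 p.2) '' (D : LowerSet (L × M))) := by
  apply le_antisymm
  · intro p hp
    have : rect p.1 p.2 ≤ sSup ((fun p : L × M => rect p.1 p.2) '' (D : LowerSet (L × M))) :=
      le_sSup ⟨p, hp, rfl⟩
    exact rect_le_iff.1 this
  · refine sSup_le ?_
    rintro _ ⟨p, hp, rfl⟩
    exact rect_le_iff.2 hp

theorem rect_mono {x x' : L} {y y' : M} (hx : x ≤ x') (hy : y ≤ y') : rect x y ≤ rect x' y' :=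
  rect_le_iff.2 ((rect x' y' : LowerSet (L × M)).lower ⟨hx, hy⟩ (rect_le_iff.1 le_rfl))

theorem rect_inf_rect (x x' : L) (y y' : M) :
    rect x y ⊓ rect x' y' = rect (x ⊓ x') (y ⊓ y') := by
  rw [rect, rect, rect, ← map_inf]
  congr 1
  ext p
  simp [Prod.le_def]

theorem rect_top_top : rect (⊤ : L) (⊤ : M) = ⊤ := by
  have : LowerSet.Iic ((⊤ : L), (⊤ : M)) = ⊤ := LowerSet.Iic_top
  rw [rect, this, map_top]

theorem sSup_rect_left (S : Set L) (y : M) :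
    rect (sSup S) y = sSup ((fun x => rect x y) '' S) := by
  apply le_antisymm
  · rw [rect_le_iff]
    refine (sSup ((fun x => rect x y) '' S)).2.1 S y fun x hx => ?_
    exact rect_le_iff.1 (le_sSup ⟨x, hx, rfl⟩)
  · refine sSup_le ?_
    rintro _ ⟨x, hx, rfl⟩
    exact rect_mono (le_sSup hx) le_rfl

theorem sSup_rect_right (x : L) (S : Set M) :
    rect x (sSup S) = sSup ((fun y => rect x y) '' S) := by
  apply le_antisymm
  · rw [rect_le_iff]
    refine (sSup ((fun y => rect x y) '' S)).2.2 x S fun y hy => ?_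
    exact rect_le_iff.1 (le_sSup ⟨y, hy, rfl⟩)
  · refine sSup_le ?_
    rintro _ ⟨y, hy, rfl⟩
    exact rect_mono le_rfl (le_sSup hy)

/-- The coproduct injection `x ↦ x ⊗ ⊤`. -/
def inlHom (L M : Type*) [Order.Frame L] [Order.Frame M] : FrameHom L (FrameCoprod L M) where
  toFun x := rect x ⊤
  map_inf' a b := by rw [rect_inf_rect, inf_idem]
  map_top' := rect_top_top
  map_sSup' S := sSup_rect_left S ⊤

/-- The coproduct injection `y ↦ ⊤ ⊗ y`. -/
def inrHom (L M : Type*) [Order.Frame L] [Order.Frame M] : FrameHom M (FrameCoprod L M) where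
  toFun y := rect ⊤ y
  map_inf' a b := by rw [rect_inf_rect, inf_idem]
  map_top' := rect_top_top
  map_sSup' S := sSup_rect_right ⊤ S

theorem inlHom_apply (x : L) : inlHom L M x = rect x ⊤ := rfl

theorem inrHom_apply (y : M) : inrHom L M y = rect ⊤ y := rfl

theorem rect_eq (x : L) (y : M) : rect x y = inlHom L M x ⊓ inrHom L M y := by
  rw [inlHom_apply, inrHom_apply, rect_inf_rect, inf_top_eq, top_inf_eq]

/-- The join-preserving extension of a function of two variables to the coproduct. -/
def biext (β : L → M → N) (D : FrameCoprod L M) : N :=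
  sSup ((fun p : L × M => β p.1 p.2) '' (D : LowerSet (L × M)))

/-- A function preserving joins in each variable extends along rectangles to a left adjoint. -/
theorem biext_gc (β : L → M → N) (h₁ : ∀ S y, β (sSup S) y = sSup ((fun x => β x y) '' S))
    (h₂ : ∀ x S, β x (sSup S) = sSup (β x '' S)) :
    ∃ g : N → FrameCoprod L M, GaloisConnection (biext β) g ∧
      ∀ x y z, rect x y ≤ g z ↔ β x y ≤ z := by
  have m₁ : ∀ x x' y, x ≤ x' → β x y ≤ β x' y := by
    intro x x' y h
    have := h₁ {x, x'} y
    rw [sSup_pair, sup_eq_right.2 h, Set.image_pair, sSup_pair] at this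
    rw [this]; exact le_sup_left
  have m₂ : ∀ x y y', y ≤ y' → β x y ≤ β x y' := by
    intro x y y' h
    have := h₂ x {y, y'}
    rw [sSup_pair, sup_eq_right.2 h, Set.image_pair, sSup_pair] at this
    rw [this]; exact le_sup_left
  refine ⟨fun z => ⟨⟨{p | β p.1 p.2 ≤ z}, ?_⟩, ?_, ?_⟩, ?_, ?_⟩
  · exact fun p q hqp hp => ((m₁ _ _ _ hqp.1).trans (m₂ _ _ _ hqp.2)).trans hp
  · intro S y h
    change β (sSup S) y ≤ z
    rw [h₁]
    refine sSup_le ?_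
    rintro _ ⟨x, hx, rfl⟩
    exact h x hx
  · intro x S h
    change β x (sSup S) ≤ z
    rw [h₂]
    refine sSup_le ?_
    rintro _ ⟨y, hy, rfl⟩
    exact h y hy
  · intro D z
    refine ⟨fun h p hp => (le_sSup ⟨p, hp, rfl⟩ : _ ≤ biext β D).trans h, fun h => sSup_le ?_⟩
    rintro _ ⟨p, hp, rfl⟩
    exact h hp
  · intro x y z
    rw [rect_le_iff]
    rfl

theorem biext_rect (β : L → M → N) (h₁ : ∀ S y, β (sSup S) y = sSup ((fun x => β x y) '' S))
    (h₂ : ∀ x S, β x (sSup S) = sSup (β x '' S)) (x : L) (y : M) :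
    biext β (rect x y) = β x y := by
  obtain ⟨g, gc, hg⟩ := biext_gc β h₁ h₂
  refine eq_of_forall_ge_iff fun z => ?_
  rw [gc, hg]

theorem map_inf_sSup_left (h : FrameHom L N) (k : FrameHom M N) (S : Set L) (y : M) :
    h (sSup S) ⊓ k y = sSup ((fun x => h x ⊓ k y) '' S) := by
  rw [map_sSup, sSup_inf_eq, sSup_image, iSup_image]

theorem map_inf_sSup_right (h : FrameHom L N) (k : FrameHom M N) (x : L) (S : Set M) :
    h x ⊓ k (sSup S) = sSup ((fun y => h x ⊓ k y) '' S) := by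
  rw [map_sSup, inf_sSup_eq, sSup_image, iSup_image]

/-- The copairing `[h, k] : L ⊗ M → N`. -/
def copair (h : FrameHom L N) (k : FrameHom M N) : FrameHom (FrameCoprod L M) N where
  toFun := biext fun x y => h x ⊓ k y
  map_inf' D E := by
    apply le_antisymm
    · refine le_inf ?_ ?_
      · exact sSup_le_sSup (Set.image_mono fun p hp => hp.1)
      · exact sSup_le_sSup (Set.image_mono fun p hp => hp.2)
    · change sSup _ ⊓ sSup _ ≤ sSup _
      rw [sSup_inf_sSup]
      refine iSup₂_le ?_
      rintro ⟨_, _⟩ ⟨⟨p, hp, rfl⟩, ⟨q, hq, rfl⟩⟩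
      refine le_trans (le_of_eq ?_) (le_sSup ⟨p ⊓ q, ⟨?_, ?_⟩, rfl⟩)
      · simp [inf_inf_inf_comm]
      · exact (D : LowerSet (L × M)).lower inf_le_left hp
      · exact (E : LowerSet (L × M)).lower inf_le_right hq
  map_top' := by
    refine le_antisymm le_top (le_trans (le_of_eq ?_) (le_sSup ⟨(⊤, ⊤), trivial, rfl⟩))
    simp
  map_sSup' S := by
    obtain ⟨g, gc, -⟩ := biext_gc (fun x y => h x ⊓ k y) (map_inf_sSup_left h k)
      (map_inf_sSup_right h k)
    rw [gc.l_sSup, sSup_image]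

theorem copair_rect (h : FrameHom L N) (k : FrameHom M N) (x : L) (y : M) :
    copair h k (rect x y) = h x ⊓ k y :=
  biext_rect (fun x y => h x ⊓ k y) (map_inf_sSup_left h k) (map_inf_sSup_right h k) x y

theorem copair_inl (h : FrameHom L N) (k : FrameHom M N) :
    (copair h k).comp (inlHom L M) = h := by
  ext x
  simp [inlHom_apply, copair_rect]

theorem copair_inr (h : FrameHom L N) (k : FrameHom M N) :
    (copair h k).comp (inrHom L M) = k := by
  ext x
  simp [inrHom_apply, copair_rect]

theorem coprod_hom_ext {f g : FrameHom (FrameCoprod L M) N}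
    (h : ∀ x y, f (rect x y) = g (rect x y)) : f = g := by
  ext D
  rw [eq_sSup_rect D, map_sSup, map_sSup, Set.image_image, Set.image_image]
  simp [h]

end Coprod

/-! ## Locale maps, open maps and products of locales -/

/-- The frame of opens of a locale. -/
def Opens (X : Locale.{u}) : Type u := (Opposite.unop (α := Frm.{u}) X).carrier

instance (X : Locale.{u}) : Order.Frame (Opens X) := (Opposite.unop (α := Frm.{u}) X).str

/-- The frame map `f⁻¹` underlying a map of locales. -/
def preimage {X Y : Locale.{u}} (f : X ⟶ Y) : FrameHom (Opens Y) (Opens X) :=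
  (Quiver.Hom.unop (V := Frm.{u}) f).hom

/-- The map of locales with a given underlying frame map. -/
def ofPreimage {X Y : Locale.{u}} (h : FrameHom (Opens Y) (Opens X)) : X ⟶ Y :=
  Quiver.Hom.op (V := Frm.{u}) (Frm.ofHom h)

theorem preimage_ofPreimage {X Y : Locale.{u}} (h : FrameHom (Opens Y) (Opens X)) :
    preimage (ofPreimage h) = h := rfl

theorem hom_ext {X Y : Locale.{u}} {f g : X ⟶ Y} (h : preimage f = preimage g) : f = g :=
  Quiver.Hom.unop_inj (C := Frm.{u}) (Frm.hom_ext h)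

theorem preimage_comp {X Y Z : Locale.{u}} (f : X ⟶ Y) (g : Y ⟶ Z) :
    preimage (f ≫ g) = (preimage f).comp (preimage g) := rfl

theorem preimage_id (X : Locale.{u}) : preimage (𝟙 X) = FrameHom.id (Opens X) := rfl

/-- A locale map `f` is open if `f⁻¹` has a left adjoint satisfying Frobenius reciprocity. -/
def OpenMap {X Y : Locale.{u}} (f : X ⟶ Y) : Prop :=
  ∃ g : Opens X → Opens Y, GaloisConnection g (preimage f) ∧
    ∀ U V, g (U ⊓ preimage f V) = g U ⊓ V

/-- The function `f_!`, given by the formula for the left adjoint of `f⁻¹`; it is the left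
adjoint whenever one exists, see `directImage_eq`. -/
def directImage {X Y : Locale.{u}} (f : X ⟶ Y) (U : Opens X) : Opens Y :=
  sInf {V : Opens Y | U ≤ preimage f V}

theorem directImage_eq {X Y : Locale.{u}} {f : X ⟶ Y} {g : Opens X → Opens Y}
    (gc : GaloisConnection g (preimage f)) : directImage f = g := by
  funext U
  exact le_antisymm (sInf_le (gc.le_u_l U)) (le_sInf fun V hV => gc.l_le hV)

theorem OpenMap.gc {X Y : Locale.{u}} {f : X ⟶ Y} (hf : OpenMap f) :
    GaloisConnection (directImage f) (preimage f) := by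
  obtain ⟨g, gc, -⟩ := hf
  rwa [directImage_eq gc]

theorem OpenMap.frobenius {X Y : Locale.{u}} {f : X ⟶ Y} (hf : OpenMap f) (U : Opens X)
    (V : Opens Y) : directImage f (U ⊓ preimage f V) = directImage f U ⊓ V := by
  obtain ⟨g, gc, hg⟩ := hf
  rw [directImage_eq gc, hg]

/-- The product of two locales. -/
def prodLocale (X Y : Locale.{u}) : Locale.{u} := Locale.of (FrameCoprod (Opens X) (Opens Y))

/-- The first projection. -/
def prFst (X Y : Locale.{u}) : prodLocale X Y ⟶ X := ofPreimage (inlHom (Opens X) (Opens Y))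

/-- The second projection. -/
def prSnd (X Y : Locale.{u}) : prodLocale X Y ⟶ Y := ofPreimage (inrHom (Opens X) (Opens Y))

/-- The pairing of two locale maps. -/
def pair {X Y Z : Locale.{u}} (f : Z ⟶ X) (g : Z ⟶ Y) : Z ⟶ prodLocale X Y :=
  ofPreimage (copair (preimage f) (preimage g))

theorem pair_fst {X Y Z : Locale.{u}} (f : Z ⟶ X) (g : Z ⟶ Y) : pair f g ≫ prFst X Y = f :=
  hom_ext (copair_inl (preimage f) (preimage g))

theorem pair_snd {X Y Z : Locale.{u}} (f : Z ⟶ X) (g : Z ⟶ Y) : pair f g ≫ prSnd X Y = g :=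
  hom_ext (copair_inr (preimage f) (preimage g))

/-- Every frame map out of a coproduct is a copairing. -/
theorem coprod_hom_ext_inj {L M N : Type*} [Order.Frame L] [Order.Frame M] [Order.Frame N]
    {f g : FrameHom (FrameCoprod L M) N} (h₁ : f.comp (inlHom L M) = g.comp (inlHom L M))
    (h₂ : f.comp (inrHom L M) = g.comp (inrHom L M)) : f = g := by
  refine coprod_hom_ext fun x y => ?_
  rw [rect_eq, map_inf, map_inf]
  exact congrArg₂ _ (DFunLike.congr_fun h₁ x) (DFunLike.congr_fun h₂ y)

theorem prod_hom_ext {X Y Z : Locale.{u}} {f g : Z ⟶ prodLocale X Y}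
    (h₁ : f ≫ prFst X Y = g ≫ prFst X Y) (h₂ : f ≫ prSnd X Y = g ≫ prSnd X Y) : f = g :=
  hom_ext (coprod_hom_ext_inj (L := Opens X) (M := Opens Y) (congrArg preimage h₁)
    (congrArg preimage h₂))

/-- The map `f × f`. -/
def prodMap {X Y : Locale.{u}} (f : X ⟶ Y) : prodLocale X X ⟶ prodLocale Y Y :=
  pair (prFst X X ≫ f) (prSnd X X ≫ f)

theorem prodMap_rect {X Y : Locale.{u}} (f : X ⟶ Y) (a b : Opens Y) :
    preimage (prodMap f) (rect a b : FrameCoprod (Opens Y) (Opens Y)) =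
      (rect (preimage f a) (preimage f b) : FrameCoprod (Opens X) (Opens X)) :=
  (copair_rect _ _ a b).trans (rect_eq (preimage f a) (preimage f b)).symm

theorem prodMap_id (X : Locale.{u}) : prodMap (𝟙 X) = 𝟙 _ :=
  hom_ext (coprod_hom_ext (L := Opens X) (M := Opens X) fun x y => prodMap_rect (𝟙 X) x y)

theorem prodMap_comp {X Y Z : Locale.{u}} (f : X ⟶ Y) (g : Y ⟶ Z) :
    prodMap (f ≫ g) = prodMap f ≫ prodMap g :=
  hom_ext (coprod_hom_ext (L := Opens Z) (M := Opens Z) fun x y =>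
    (prodMap_rect (f ≫ g) x y).trans
      ((prodMap_rect f _ _).symm.trans
        (congrArg (preimage (prodMap f)) (prodMap_rect g x y).symm)))

/-! ## Localic relations -/

/-- A localic relation on `X` is a sublocale of `X × X`. -/
abbrev LocalicRel (X : Locale.{u}) : Type u := Sublocale (FrameCoprod (Opens X) (Opens X))

/-- The locale underlying a localic relation. -/
def relLocale {X : Locale.{u}} (R : LocalicRel X) : Locale.{u} := Locale.of R

/-- The sublocale inclusion `r : R ↣ X × X`. -/
def incl {X : Locale.{u}} (R : LocalicRel X) : relLocale R ⟶ prodLocale X X :=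
  ofPreimage R.restrict

/-- The source map `s`. -/
def source {X : Locale.{u}} (R : LocalicRel X) : relLocale R ⟶ X := incl R ≫ prFst X X

/-- The target map `t`. -/
def target {X : Locale.{u}} (R : LocalicRel X) : relLocale R ⟶ X := incl R ≫ prSnd X X

/-- A localic relation has open cones if its source and target maps are open. -/
def HasOpenCones {X : Locale.{u}} (R : LocalicRel X) : Prop :=
  OpenMap (source R) ∧ OpenMap (target R)

/-- The induced up cone `t_! s⁻¹`. -/
def upCone {X : Locale.{u}} (R : LocalicRel X) (U : Opens X) : Opens X :=
  directImage (target R) (preimage (source R) U)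

/-- The induced down cone `s_! t⁻¹`. -/
def downCone {X : Locale.{u}} (R : LocalicRel X) (U : Opens X) : Opens X :=
  directImage (source R) (preimage (target R) U)

/-- The kernel pair `X ×_Q X ↣ X × X` of `q : X ⟶ Q`: the equaliser of `q ∘ pr₁` and `q ∘ pr₂`,
that is, the sublocale obtained by identifying `q⁻¹ V ⊗ ⊤` with `⊤ ⊗ q⁻¹ V`. -/
def kernelPair {X Q : Locale.{u}} (q : X ⟶ Q) : LocalicRel X :=
  saturated fun a b => ∃ V : Opens Q, a = rect (preimage q V) ⊤ ∧ b = rect ⊤ (preimage q V)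

/-- The source and target of the kernel pair are the pullback of `q` along itself. -/
theorem kernelPair_isPullback {X Q : Locale.{u}} (q : X ⟶ Q) :
    IsPullback (source (kernelPair q)) (target (kernelPair q)) q q := by
  have w : source (kernelPair q) ≫ q = target (kernelPair q) ≫ q := by
    refine hom_ext (DFunLike.ext _ _ fun V => ?_)
    exact restrict_saturated_eq ⟨V, rfl, rfl⟩
  have hc : ∀ (Z : Locale.{u}) (f g : Z ⟶ X), f ≫ q = g ≫ q →
      ∃ m : Z ⟶ relLocale (kernelPair q), m ≫ incl (kernelPair q) = pair f g := by
    intro Z f g hfg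
    have hS := apply_restrict_saturated
      (fun a b => ∃ V : Opens Q, a = rect (preimage q V) ⊤ ∧ b = rect ⊤ (preimage q V))
      (copair (preimage f) (preimage g)) (by
        rintro _ _ ⟨V, rfl, rfl⟩
        rw [copair_rect, copair_rect, map_top, map_top, inf_top_eq, top_inf_eq]
        exact DFunLike.congr_fun (congrArg preimage hfg) V)
    exact ⟨ofPreimage (factor (kernelPair q) _ hS), hom_ext (factor_restrict (kernelPair q) _ hS)⟩
  have he : ∀ (Z : Locale.{u}) (m m' : Z ⟶ relLocale (kernelPair q)),
      m ≫ incl (kernelPair q) = m' ≫ incl (kernelPair q) → m = m' := fun Z m m' h =>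
    hom_ext (restrict_hom_ext (kernelPair q) fun x =>
      DFunLike.congr_fun (congrArg preimage h) x)
  choose m hm using hc
  refine ⟨⟨w⟩, ⟨Limits.PullbackCone.IsLimit.mk w (fun c => m _ c.fst c.snd c.condition)
    (fun c => ?_) (fun c => ?_) (fun c l h₁ h₂ => he _ _ _ ?_)⟩⟩
  · rw [source, ← Category.assoc, hm, pair_fst]
  · rw [target, ← Category.assoc, hm, pair_snd]
  · rw [hm]
    refine prod_hom_ext ?_ ?_
    · rw [pair_fst, Category.assoc]; exact h₁
    · rw [pair_snd, Category.assoc]; exact h₂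

/-! ## Cones on frames and the relations they induce -/

section Cones

variable {L : Type*} [Order.Frame L]

/-- Parallel pairs of cones. -/
def Parallel (up down : L → L) : Prop :=
  ∀ x y, up x ⊓ y ≤ up (x ⊓ down y) ∧ x ⊓ down y ≤ down (up x ⊓ y)

/-- Equality of the reduced cones of two rectangles: this is the condition on `a, b, c, d` that
defines `a ⊗ b ∼ c ⊗ d`. -/
def SameCones (up down : L → L) (a b c d : L) : Prop :=
  up a ⊓ b = up c ⊓ d ∧ a ⊓ down b = c ⊓ down d

/-- The relation `∼` on the rectangles of `L ⊗ L` induced by a pair of cones. -/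
def coneSim (up down : L → L) (p q : FrameCoprod L L) : Prop :=
  ∃ a b c d, p = rect a b ∧ q = rect c d ∧ SameCones up down a b c d

/-- The localic relation induced by a pair of cones: the sublocale generated by `∼`. -/
def inducedRel (up down : L → L) : Sublocale (FrameCoprod L L) := saturated (coneSim up down)

/-- Preservation of all joins. -/
def JoinPreserving (f : L → L) : Prop := ∀ S : Set L, f (sSup S) = sSup (f '' S)

theorem JoinPreserving.mono {f : L → L} (hf : JoinPreserving f) {x y : L} (h : x ≤ y) :
    f x ≤ f y := by
  have := hf {x, y}
  rw [sSup_pair, sup_eq_right.2 h, Set.image_pair, sSup_pair] at this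
  rw [this]; exact le_sup_left

variable {up down : L → L}

theorem SameCones.reduce (hp : Parallel up down) (x y : L) :
    SameCones up down x y (x ⊓ down y) (up x ⊓ y) :=
  ⟨le_antisymm (le_inf (hp x y).1 le_rfl) inf_le_right,
    le_antisymm (le_inf le_rfl (hp x y).2) inf_le_left⟩

theorem SameCones.inf_le (hu : JoinPreserving up) (hd : JoinPreserving down)
    (hp : Parallel up down) {a b c d : L} (h : SameCones up down a b c d) (x y : L) :
    up (a ⊓ x) ⊓ (b ⊓ y) ≤ up (c ⊓ x) ⊓ (d ⊓ y) ∧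
      (a ⊓ x) ⊓ down (b ⊓ y) ≤ (c ⊓ x) ⊓ down (d ⊓ y) := by
  have h₁ : (a ⊓ x) ⊓ down (b ⊓ y) ≤ c ⊓ x := by
    refine le_inf ?_ (inf_le_left.trans inf_le_right)
    exact (inf_le_inf inf_le_left (hd.mono inf_le_left)).trans (h.2.le.trans inf_le_left)
  have h₂ : up (a ⊓ x) ⊓ (b ⊓ y) ≤ d ⊓ y := by
    refine le_inf ?_ (inf_le_right.trans inf_le_right)
    exact (inf_le_inf (hu.mono inf_le_left) inf_le_left).trans (h.1.le.trans inf_le_right)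
  have hr := SameCones.reduce hp (a ⊓ x) (b ⊓ y)
  exact ⟨hr.1.le.trans (inf_le_inf (hu.mono h₁) h₂),
    hr.2.le.trans (inf_le_inf h₁ (hd.mono h₂))⟩

theorem SameCones.inf (hu : JoinPreserving up) (hd : JoinPreserving down)
    (hp : Parallel up down) {a b c d : L} (h : SameCones up down a b c d) (x y : L) :
    SameCones up down (a ⊓ x) (b ⊓ y) (c ⊓ x) (d ⊓ y) := by
  have h₁ := SameCones.inf_le hu hd hp h x y
  have h₂ := SameCones.inf_le hu hd hp (a := c) (b := d) ⟨h.1.symm, h.2.symm⟩ x y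
  exact ⟨le_antisymm h₁.1 h₂.1, le_antisymm h₁.2 h₂.2⟩

theorem restrict_inducedRel_eq {a b c d : L} (h : SameCones up down a b c d) :
    (inducedRel up down).restrict (rect a b) = (inducedRel up down).restrict (rect c d) :=
  restrict_saturated_eq ⟨a, b, c, d, rfl, rfl, h⟩

/-- The common construction of the left adjoints of the source and target maps of an induced
relation. -/
theorem inducedRel_adj (β : L → L → L)
    (h₁ : ∀ S y, β (sSup S) y = sSup ((fun x => β x y) '' S))
    (h₂ : ∀ x S, β x (sSup S) = sSup (β x '' S))
    (hsat : ∀ a b c d, SameCones up down a b c d → ∀ x y, β (a ⊓ x) (b ⊓ y) = β (c ⊓ x) (d ⊓ y))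
    (e₁ e₂ : L → L) (hle : ∀ z, β (e₁ z) (e₂ z) ≤ z)
    (hred : ∀ x y z, β x y ≤ z → ∃ a b, SameCones up down x y a b ∧ a ≤ e₁ z ∧ b ≤ e₂ z)
    (hfrob : ∀ x y z, ∃ x' ≤ x, ∃ y' ≤ y, β x' y' = β x y ⊓ z) :
    ∃ g : inducedRel up down → L,
      GaloisConnection g (fun z => (inducedRel up down).restrict (rect (e₁ z) (e₂ z))) ∧
      (∀ D z, g (D ⊓ (inducedRel up down).restrict (rect (e₁ z) (e₂ z))) = g D ⊓ z) ∧
      ∀ x y, g ((inducedRel up down).restrict (rect x y)) = β x y := by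
  obtain ⟨k, gc, hk⟩ := biext_gc β h₁ h₂
  have hs : ∀ z, k z ∈ inducedRel up down := by
    have key : ∀ z a b c d, SameCones up down a b c d → ∀ E : FrameCoprod L L,
        rect a b ⊓ E ≤ k z → rect c d ⊓ E ≤ k z := by
      intro z a b c d h E hE
      rw [eq_sSup_rect E, inf_sSup_eq]
      refine iSup₂_le ?_
      rintro _ ⟨p, hp, rfl⟩
      dsimp only
      rw [rect_inf_rect, hk, ← hsat a b c d h, ← hk, ← rect_inf_rect]
      exact (inf_le_inf_left _ (rect_le_iff.2 hp)).trans hE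
    rintro z _ _ E ⟨a, b, c, d, rfl, rfl, h⟩
    exact ⟨key z a b c d h E, key z c d a b ⟨h.1.symm, h.2.symm⟩ E⟩
  have hkz : ∀ z, ((inducedRel up down).restrict (rect (e₁ z) (e₂ z)) : FrameCoprod L L) = k z := by
    intro z
    apply le_antisymm
    · have : (inducedRel up down).restrict (rect (e₁ z) (e₂ z)) ≤ ⟨k z, hs z⟩ := by
        rw [restrict_le_iff]
        exact (hk _ _ _).2 (hle z)
      exact this
    · rw [eq_sSup_rect (k z)]
      refine sSup_le ?_
      rintro _ ⟨p, hp, rfl⟩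
      obtain ⟨a, b, hab, ha, hb⟩ := hred p.1 p.2 z ((hk _ _ _).1 (rect_le_iff.2 hp))
      dsimp only
      rw [← restrict_le_iff, restrict_inducedRel_eq hab]
      exact OrderHomClass.mono _ (rect_mono ha hb)
  have gc2 : GaloisConnection (fun D : inducedRel up down => biext β (D : FrameCoprod L L))
      (fun z => (inducedRel up down).restrict (rect (e₁ z) (e₂ z))) := by
    intro D z
    rw [gc, ← hkz]
    rfl
  refine ⟨_, gc2, fun D z => ?_, fun x y => ?_⟩
  · apply le_antisymm
    · exact le_inf (gc2.monotone_l inf_le_left) ((gc2 _ _).2 inf_le_right)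
    · change sSup _ ⊓ z ≤ _
      rw [sSup_inf_eq]
      refine iSup₂_le ?_
      rintro _ ⟨p, hp, rfl⟩
      obtain ⟨x', hx, y', hy, h⟩ := hfrob p.1 p.2 z
      refine (le_of_eq h.symm).trans (le_sSup ⟨(x', y'), ?_, rfl⟩)
      have hD : rect x' y' ≤ (D : FrameCoprod L L) :=
        rect_le_iff.2 (LowerSet.lower _ (show (x', y') ≤ p from ⟨hx, hy⟩) hp)
      have hz : rect x' y' ≤
          ((inducedRel up down).restrict (rect (e₁ z) (e₂ z)) : FrameCoprod L L) := by
        rw [hkz, hk, h]; exact inf_le_right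
      exact rect_le_iff.1 (le_inf hD hz)
  · refine eq_of_forall_ge_iff fun z => ?_
    rw [gc2, restrict_le_iff, hkz, hk]

end Cones

section OpenCones

variable {X : Locale.{u}} {up down : Opens X → Opens X}

theorem inducedRel_source (hu : JoinPreserving up) (hd : JoinPreserving down)
    (hp : Parallel up down) :
    OpenMap (source (inducedRel up down)) ∧ ∀ x y, directImage (source (inducedRel up down))
      ((inducedRel up down).restrict (rect x y)) = x ⊓ down y := by
  obtain ⟨g, gc, hf, hg⟩ := inducedRel_adj (up := up) (down := down) (fun x y => x ⊓ down y)
    (fun S y => by rw [sSup_inf_eq, sSup_image])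
    (fun x S => by rw [hd, inf_sSup_eq, sSup_image, iSup_image])
    (fun a b c d h x y => (h.inf hu hd hp x y).2) id (fun _ => ⊤) (fun z => inf_le_left)
    (fun x y z h => ⟨_, _, SameCones.reduce hp x y, h, le_top⟩)
    (fun x y z => ⟨x ⊓ z, inf_le_left, y, le_rfl, inf_right_comm x z (down y)⟩)
  have gc' : GaloisConnection (α := Opens (relLocale (inducedRel up down))) g
      (preimage (source (inducedRel up down))) := gc
  exact ⟨⟨g, gc, hf⟩, by rw [directImage_eq gc']; exact hg⟩

theorem inducedRel_target (hu : JoinPreserving up) (hd : JoinPreserving down)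
    (hp : Parallel up down) :
    OpenMap (target (inducedRel up down)) ∧ ∀ x y, directImage (target (inducedRel up down))
      ((inducedRel up down).restrict (rect x y)) = up x ⊓ y := by
  obtain ⟨g, gc, hf, hg⟩ := inducedRel_adj (up := up) (down := down) (fun x y => up x ⊓ y)
    (fun S y => by rw [hu, sSup_inf_eq, sSup_image, iSup_image])
    (fun x S => by rw [inf_sSup_eq, sSup_image])
    (fun a b c d h x y => (h.inf hu hd hp x y).1) (fun _ => ⊤) id (fun z => inf_le_right)
    (fun x y z h => ⟨_, _, SameCones.reduce hp x y, le_top, h⟩)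
    (fun x y z => ⟨x, le_rfl, y ⊓ z, inf_le_left, (inf_assoc (up x) y z).symm⟩)
  have gc' : GaloisConnection (α := Opens (relLocale (inducedRel up down))) g
      (preimage (target (inducedRel up down))) := gc
  exact ⟨⟨g, gc, hf⟩, by rw [directImage_eq gc']; exact hg⟩

/-- The relation induced by a join-preserving parallel pair of cones has open cones. -/
theorem inducedRel_hasOpenCones (hu : JoinPreserving up) (hd : JoinPreserving down)
    (hp : Parallel up down) : HasOpenCones (inducedRel up down) :=
  ⟨(inducedRel_source hu hd hp).1, (inducedRel_target hu hd hp).1⟩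

theorem upCone_inducedRel (hu : JoinPreserving up) (hd : JoinPreserving down)
    (hp : Parallel up down) : upCone (inducedRel up down) = up :=
  funext fun x => ((inducedRel_target hu hd hp).2 x ⊤).trans (inf_top_eq _)

theorem downCone_inducedRel (hu : JoinPreserving up) (hd : JoinPreserving down)
    (hp : Parallel up down) : downCone (inducedRel up down) = down :=
  funext fun x => ((inducedRel_source hu hd hp).2 ⊤ x).trans (top_inf_eq _)

variable {R : LocalicRel X}

theorem restrict_rect (R : LocalicRel X) (a b : Opens X) :
    R.restrict (rect a b) = preimage (source R) a ⊓ preimage (target R) b := by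
  rw [rect_eq, map_inf]
  rfl

theorem upCone_joinPreserving (hR : HasOpenCones R) : JoinPreserving (upCone R) := by
  intro S
  unfold upCone
  rw [map_sSup, hR.2.gc.l_sSup, sSup_image, iSup_image]

theorem downCone_joinPreserving (hR : HasOpenCones R) : JoinPreserving (downCone R) := by
  intro S
  unfold downCone
  rw [map_sSup, hR.1.gc.l_sSup, sSup_image, iSup_image]

theorem directImage_target_inf (hR : HasOpenCones R) (a b : Opens X) :
    directImage (target R) (preimage (source R) a ⊓ preimage (target R) b) = upCone R a ⊓ b :=
  hR.2.frobenius _ _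

theorem directImage_source_inf (hR : HasOpenCones R) (a b : Opens X) :
    directImage (source R) (preimage (source R) a ⊓ preimage (target R) b) =
      a ⊓ downCone R b := by
  rw [inf_comm, hR.1.frobenius, inf_comm]
  rfl

theorem cones_parallel (hR : HasOpenCones R) : Parallel (upCone R) (downCone R) := by
  intro x y
  constructor
  · rw [← directImage_target_inf hR]
    refine hR.2.gc.monotone_l ?_
    rw [map_inf]
    exact inf_le_inf_left _ (hR.1.gc.le_u_l _)
  · rw [← directImage_source_inf hR]
    refine hR.1.gc.monotone_l ?_
    rw [map_inf]
    exact inf_le_inf_right _ (hR.2.gc.le_u_l _)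

/-- On rectangles, the congruence of a relation with open cones is the relation `∼`. -/
theorem restrict_rect_eq_iff (hR : HasOpenCones R) (a b c d : Opens X) :
    R.restrict (rect a b) = R.restrict (rect c d) ↔
      SameCones (upCone R) (downCone R) a b c d := by
  have hred : ∀ x y : Opens X, R.restrict (rect x y) =
      R.restrict (rect (x ⊓ downCone R y) (upCone R x ⊓ y)) := by
    intro x y
    rw [restrict_rect, restrict_rect, map_inf, map_inf]
    have h₁ : preimage (target R) y ≤ preimage (source R) (downCone R y) := hR.1.gc.le_u_l _
    have h₂ : preimage (source R) x ≤ preimage (target R) (upCone R x) := hR.2.gc.le_u_l _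
    exact le_antisymm (le_inf (le_inf inf_le_left (inf_le_right.trans h₁))
      (le_inf (inf_le_left.trans h₂) inf_le_right)) (inf_le_inf inf_le_left inf_le_right)
  constructor
  · intro h
    rw [restrict_rect, restrict_rect] at h
    rw [SameCones, ← directImage_target_inf hR, ← directImage_target_inf hR,
      ← directImage_source_inf hR, ← directImage_source_inf hR, h]
    exact ⟨rfl, rfl⟩
  · intro h
    rw [hred a b, hred c d, h.1, h.2]

end OpenCones

/-! ## The category of locales equipped with relations -/

/-- A locale equipped with a localic relation. -/
structure RelLoc : Type (u + 1) where
  /-- The underlying locale. -/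
  X : Locale.{u}
  /-- The relation. -/
  rel : LocalicRel X

/-- A locale map `f` is monotone if `f × f` restricts to the relations. -/
def MonotoneMap {A B : RelLoc.{u}} (f : A.X ⟶ B.X) : Prop :=
  ∃ g : relLocale A.rel ⟶ relLocale B.rel, g ≫ incl B.rel = incl A.rel ≫ prodMap f

/-- Monotone maps between locales equipped with localic relations. -/
@[ext]
structure RelLoc.Hom (A B : RelLoc.{u}) : Type u where
  /-- The underlying map of locales. -/
  base : A.X ⟶ B.X
  mono : MonotoneMap base

instance : Category RelLoc.{u} where
  Hom := RelLoc.Hom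
  id A := ⟨𝟙 A.X, 𝟙 _, by rw [prodMap_id, Category.id_comp, Category.comp_id]⟩
  comp f g := ⟨f.base ≫ g.base, by
    obtain ⟨f', hf⟩ := f.mono
    obtain ⟨g', hg⟩ := g.mono
    exact ⟨f' ≫ g', by rw [Category.assoc, hg, ← Category.assoc, hf, Category.assoc,
      prodMap_comp]⟩⟩
  id_comp f := RelLoc.Hom.ext (Category.id_comp f.base)
  comp_id f := RelLoc.Hom.ext (Category.comp_id f.base)
  assoc f g h := RelLoc.Hom.ext (Category.assoc f.base g.base h.base)

/-- The full subcategory of locales equipped with an open cone relation. -/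
abbrev OpenConeLoc : Type (u + 1) :=
  ObjectProperty.FullSubcategory fun A : RelLoc.{u} => HasOpenCones A.rel

/-! ## The category of conic frames -/

/-- A conic frame is a frame with join-preserving parallel cones. -/
structure ConicFrame : Type (u + 1) where
  /-- The underlying frame. -/
  carrier : Type u
  [frame : Order.Frame carrier]
  /-- The up cone. -/
  up : carrier → carrier
  /-- The down cone. -/
  down : carrier → carrier
  up_join : JoinPreserving up
  down_join : JoinPreserving down
  parallel : Parallel up down

attribute [instance] ConicFrame.frame

/-- Conic morphisms between frames with cones. -/
def Conic {L M : Type*} [Order.Frame L] [Order.Frame M] (up down : L → L) (up' down' : M → M)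
    (h : FrameHom L M) : Prop :=
  (∀ x, up' (h x) ≤ h (up x)) ∧ ∀ x, down' (h x) ≤ h (down x)

/-- Conic morphisms. -/
@[ext]
structure ConicFrame.Hom (C D : ConicFrame.{u}) : Type u where
  /-- The underlying frame map. -/
  hom : FrameHom C.carrier D.carrier
  conic : Conic C.up C.down D.up D.down hom

instance : Category ConicFrame.{u} where
  Hom := ConicFrame.Hom
  id C := ⟨FrameHom.id _, fun _ => le_rfl, fun _ => le_rfl⟩
  comp f g := ⟨g.hom.comp f.hom,
    fun x => (g.conic.1 (f.hom x)).trans (OrderHomClass.mono g.hom (f.conic.1 x)),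
    fun x => (g.conic.2 (f.hom x)).trans (OrderHomClass.mono g.hom (f.conic.2 x))⟩

/-- Conic morphisms are the frame maps preserving `∼`. -/
theorem conic_iff {L M : Type*} [Order.Frame L] [Order.Frame M] {up down : L → L}
    {up' down' : M → M} (hp : Parallel up down) (hp' : Parallel up' down')
    (hu' : JoinPreserving up') (hd' : JoinPreserving down') (h : FrameHom L M) :
    Conic up down up' down' h ↔ ∀ a b c d, SameCones up down a b c d →
      SameCones up' down' (h a) (h b) (h c) (h d) := by
  constructor
  · intro hh
    have key : ∀ x y, SameCones up' down' (h x) (h y) (h (x ⊓ down y)) (h (up x ⊓ y)) := by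
      intro x y
      have h₁ : up' (h x) ⊓ h y ≤ h (up x ⊓ y) := by
        rw [map_inf]; exact inf_le_inf_right _ (hh.1 x)
      have h₂ : h x ⊓ down' (h y) ≤ h (x ⊓ down y) := by
        rw [map_inf]; exact inf_le_inf_left _ (hh.2 y)
      have hr := SameCones.reduce hp' (h x) (h y)
      have m₁ : h (x ⊓ down y) ≤ h x := OrderHomClass.mono h inf_le_left
      have m₂ : h (up x ⊓ y) ≤ h y := OrderHomClass.mono h inf_le_right
      exact ⟨le_antisymm (hr.1.le.trans (inf_le_inf (hu'.mono h₂) h₁))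
          (inf_le_inf (hu'.mono m₁) m₂),
        le_antisymm (hr.2.le.trans (inf_le_inf h₂ (hd'.mono h₁)))
          (inf_le_inf m₁ (hd'.mono m₂))⟩
    intro a b c d hs
    have k₁ := key a b
    have k₂ := key c d
    rw [hs.1, hs.2] at k₁
    exact ⟨k₁.1.trans k₂.1.symm, k₁.2.trans k₂.2.symm⟩
  · intro hh
    constructor
    · intro x
      have := (hh _ _ _ _ (SameCones.reduce hp x ⊤)).1
      rw [map_top, inf_top_eq, inf_top_eq] at this
      rw [this]
      exact inf_le_right
    · intro y
      have := (hh _ _ _ _ (SameCones.reduce hp ⊤ y)).2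
      rw [map_top, top_inf_eq, top_inf_eq] at this
      rw [this]
      exact inf_le_left

/-! ## The adjunction between open cone relations and conic frames -/

theorem incl_prodMap_rect {X Y : Locale.{u}} (R : LocalicRel X) (f : X ⟶ Y) (a b : Opens Y) :
    preimage (incl R ≫ prodMap f) (rect a b : FrameCoprod (Opens Y) (Opens Y)) =
      R.restrict (rect (preimage f a) (preimage f b)) :=
  congrArg R.restrict (prodMap_rect f a b)

/-- Monotone maps between open cone relations induce conic morphisms. -/
theorem conic_of_monotone {A B : RelLoc.{u}} (hA : HasOpenCones A.rel) (hB : HasOpenCones B.rel)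
    (f : A.X ⟶ B.X) (hf : MonotoneMap f) :
    Conic (upCone B.rel) (downCone B.rel) (upCone A.rel) (downCone A.rel) (preimage f) := by
  obtain ⟨g, hg⟩ := hf
  rw [conic_iff (cones_parallel hB) (cones_parallel hA) (upCone_joinPreserving hA)
    (downCone_joinPreserving hA)]
  intro a b c d h
  rw [← restrict_rect_eq_iff hB] at h
  rw [← restrict_rect_eq_iff hA, ← incl_prodMap_rect, ← incl_prodMap_rect, ← hg]
  exact congrArg (preimage g) h

/-- A conic morphism is monotone for the induced relation. -/
theorem monotone_of_conic {A : RelLoc.{u}} (hA : HasOpenCones A.rel) {Y : Locale.{u}}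
    {up down : Opens Y → Opens Y} (hp : Parallel up down) (f : A.X ⟶ Y)
    (hf : Conic up down (upCone A.rel) (downCone A.rel) (preimage f)) :
    MonotoneMap (A := A) (B := ⟨Y, inducedRel up down⟩) f := by
  rw [conic_iff hp (cones_parallel hA) (upCone_joinPreserving hA)
    (downCone_joinPreserving hA)] at hf
  have hS := apply_restrict_saturated (coneSim up down)
    (M := Opens (relLocale A.rel)) (preimage (incl A.rel ≫ prodMap f)) (by
      rintro _ _ ⟨a, b, c, d, rfl, rfl, h⟩
      have := (restrict_rect_eq_iff hA _ _ _ _).2 (hf a b c d h)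
      rw [← incl_prodMap_rect, ← incl_prodMap_rect] at this
      exact this)
  exact ⟨ofPreimage (factor (inducedRel up down) _ hS),
    hom_ext (factor_restrict (inducedRel up down) _ hS)⟩

/-- The conic frame of an open cone relation. -/
def conicOf (A : OpenConeLoc.{u}) : ConicFrame.{u} where
  carrier := Opens A.obj.X
  up := upCone A.obj.rel
  down := downCone A.obj.rel
  up_join := upCone_joinPreserving A.property
  down_join := downCone_joinPreserving A.property
  parallel := cones_parallel A.property

/-- The open cone relation of a conic frame. -/
def relOf (C : ConicFrame.{u}) : OpenConeLoc.{u} where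
  obj := ⟨Locale.of C.carrier, inducedRel C.up C.down⟩
  property := inducedRel_hasOpenCones C.up_join C.down_join C.parallel

theorem upCone_relOf (C : ConicFrame.{u}) : upCone (relOf C).obj.rel = C.up :=
  upCone_inducedRel (X := Locale.of C.carrier) C.up_join C.down_join C.parallel

theorem downCone_relOf (C : ConicFrame.{u}) : downCone (relOf C).obj.rel = C.down :=
  downCone_inducedRel (X := Locale.of C.carrier) C.up_join C.down_join C.parallel

theorem OpenConeLoc.hom_ext {A B : OpenConeLoc.{u}} {f g : A ⟶ B}
    (h : f.hom.base = g.hom.base) : f = g :=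
  ObjectProperty.hom_ext _ (RelLoc.Hom.ext h)

/-- The functor `(X, R) ↦ (𝒪 X, ⇑, ⇓)`, `f ↦ f⁻¹`. -/
def coneFunctor : OpenConeLoc.{u} ⥤ ConicFrame.{u}ᵒᵖ where
  obj A := Opposite.op (conicOf A)
  map {A B} f := Quiver.Hom.op (X := conicOf B) (Y := conicOf A)
    ⟨preimage f.hom.base, conic_of_monotone A.property B.property _ f.hom.mono⟩

/-- A conic morphism `C ⟶ (𝒪 X, ⇑, ⇓)`, seen as a monotone map. -/
def toMonotone {A : OpenConeLoc.{u}} {C : ConicFrame.{u}} (h : C ⟶ conicOf A) : A ⟶ relOf C :=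
  ObjectProperty.homMk ⟨ofPreimage (X := A.obj.X) (Y := Locale.of C.carrier) h.hom,
    monotone_of_conic (A := A.obj) (Y := Locale.of C.carrier) A.property C.parallel _ h.conic⟩

/-- A monotone map into an induced relation, seen as a conic morphism. -/
def toConic {A : OpenConeLoc.{u}} {C : ConicFrame.{u}} (f : A ⟶ relOf C) : C ⟶ conicOf A :=
  ⟨preimage f.hom.base, by
    have h := conic_of_monotone A.property (relOf C).property f.hom.base f.hom.mono
    rw [upCone_relOf, downCone_relOf] at h
    exact h⟩

/-- The functor `(𝒪 X, up, down) ↦ (X, R)` with `R` the induced relation, `f⁻¹ ↦ f`. -/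
def relFunctor : ConicFrame.{u}ᵒᵖ ⥤ OpenConeLoc.{u} where
  obj C := relOf C.unop
  map {C _} f := toMonotone (f.unop ≫ toConic (𝟙 (relOf C.unop)))
  map_id _ := OpenConeLoc.hom_ext rfl
  map_comp _ _ := OpenConeLoc.hom_ext rfl

theorem relFunctor_map_base {C D : ConicFrame.{u}ᵒᵖ} (f : C ⟶ D) :
    preimage (relFunctor.map f).hom.base = f.unop.hom := rfl

/-- The adjunction between open cone relations and conic frames. Its unit at `(X, R)` is carried
by the identity map of `X`. -/
def coneRelAdjunction : coneFunctor.{u} ⊣ relFunctor.{u} :=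
  Adjunction.mkOfHomEquiv
    { homEquiv := fun _ _ =>
        { toFun := fun h => toMonotone h.unop
          invFun := fun f => (toConic f).op
          left_inv := fun _ => rfl
          right_inv := fun _ => rfl }
      homEquiv_naturality_left_symm := fun _ _ => rfl
      homEquiv_naturality_right := fun _ _ => rfl }

theorem coneRelAdjunction_unit_base (A : OpenConeLoc.{u}) :
    (coneRelAdjunction.unit.app A).hom.base = 𝟙 A.obj.X := rfl

/-- An open cone relation is a fixed point of the adjunction if the unit is an isomorphism. -/
def IsFixedPoint (A : OpenConeLoc.{u}) : Prop := IsIso (coneRelAdjunction.unit.app A)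

end Localic

namespace Localic

/-! Write `u = q⁻¹ q_!`. The heart of the proof is that two presentations define the same quotient
of `𝒪X ⊗ 𝒪X`: the one defining `K`, which identifies `q⁻¹V ⊗ ⊤` with `⊤ ⊗ q⁻¹V`, and the one
defining `R_{u,u}`, which identifies rectangles with equal reduced cones. It suffices that each
quotient identifies the generators of the other (`le_saturated_of_restrict_eq`).

In `K`, the inequality `a ≤ u a` together with `s⁻¹ q⁻¹ = t⁻¹ q⁻¹` makes `a ⊗ b` equal to `(a ⊓ u b)
⊗ (u a ⊓ b)` (`kernelPair_restrict_rect`). The image of a rectangle in `K` therefore depends only on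
its reduced cones. Conversely, Frobenius reciprocity shows that `q⁻¹V ⊗ ⊤` and `⊤ ⊗ q⁻¹V` have the
same reduced cones (`fiberHull_preimage`).

Frobenius also makes `(u, u)` a parallel pair (`fiberHull_parallel`), and `u` preserves joins. The
general theory of relations induced by such pairs then applies to `K = R_{u,u}`: it has open cones,
and both cones are `u`. No separate argument about pullbacks of open maps is needed. Thus `K` is
induced by its own cones, and the identity of `X` underlies an inverse of the unit
(`isFixedPoint_of_eq`). -/

/-- The universal property of a quotient by generators, in terms of sublocales: a quotient that
identifies all generating pairs is coarser than the generated one, so its sublocale is smaller. -/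
theorem le_saturated_of_restrict_eq {L : Type*} [Order.Frame L] {r : L → L → Prop}
    (S : Sublocale L) (h : ∀ a b, r a b → S.restrict a = S.restrict b) : S ≤ saturated r := by
  intro s hs a b c hab
  -- Since `s` lies in `S`, the condition `x ⊓ c ≤ s` can be tested in the quotient, where it sees
  -- `x` only through `S.restrict x`.
  have key : ∀ x, x ⊓ c ≤ s ↔ S.restrict x ⊓ S.restrict c ≤ ⟨s, hs⟩ := fun x => by
    rw [← map_inf, restrict_le_iff]
  rw [key, key, h a b hab]

/-! ### The operator `q⁻¹ q_!` and the presentation of the kernel pair -/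

section KernelPair

variable {X Q : Locale.{u}} {q : X ⟶ Q}

/-- The saturation `q⁻¹ q_!` of an open along an open map. -/
def fiberHull (q : X ⟶ Q) (U : Opens X) : Opens X := preimage q (directImage q U)

theorem le_fiberHull (hq : OpenMap q) (U : Opens X) : U ≤ fiberHull q U := hq.gc.le_u_l U

/-- A left adjoint followed by a frame map; Frobenius plays no role here. -/
theorem fiberHull_joinPreserving (hq : OpenMap q) : JoinPreserving (fiberHull q) := by
  intro S
  unfold fiberHull
  rw [hq.gc.l_sSup, ← sSup_image, map_sSup, Set.image_image]

/-- Frobenius reciprocity for `q`, transported to `X` by applying `q⁻¹`. This is the form in which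
openness of `q` enters the two lemmas below. -/
theorem fiberHull_inf_preimage (hq : OpenMap q) (U : Opens X) (V : Opens Q) :
    fiberHull q (U ⊓ preimage q V) = fiberHull q U ⊓ preimage q V := by
  unfold fiberHull
  rw [hq.frobenius, map_inf]

/-- The factor `fiberHull q ⊤` equals `⊤`, but it is kept because the right-hand side is then
literally the reduced up cone of `⊤ ⊗ q⁻¹V`. -/
theorem fiberHull_preimage (hq : OpenMap q) (V : Opens Q) :
    fiberHull q (preimage q V) = fiberHull q ⊤ ⊓ preimage q V := by
  rw [← fiberHull_inf_preimage hq, top_inf_eq]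

/-- A hull is itself a preimage along `q`, so Frobenius turns both right-hand sides into the meet of
the two hulls. What remains is that every open lies below its hull. -/
theorem fiberHull_parallel (hq : OpenMap q) : Parallel (fiberHull q) (fiberHull q) := by
  intro x y
  have hx : fiberHull q (x ⊓ fiberHull q y) = fiberHull q x ⊓ fiberHull q y :=
    fiberHull_inf_preimage hq x _
  have hy : fiberHull q (y ⊓ fiberHull q x) = fiberHull q y ⊓ fiberHull q x :=
    fiberHull_inf_preimage hq y _
  rw [inf_comm (fiberHull q x) y, hx, hy, inf_comm y]
  exact ⟨inf_le_inf_left _ (le_fiberHull hq y),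
    (inf_comm _ _).trans_le (inf_le_inf_left _ (le_fiberHull hq x))⟩

/-- The commutative square `q ∘ s = q ∘ t`, read on opens; each `V` gives one generating pair of
`K`. -/
theorem source_preimage_eq_target_preimage (q : X ⟶ Q) (V : Opens Q) :
    preimage (source (kernelPair q)) (preimage q V) =
      preimage (target (kernelPair q)) (preimage q V) :=
  restrict_saturated_eq ⟨V, rfl, rfl⟩

/-- On `K`, `s⁻¹ a ≤ s⁻¹ (u a) = t⁻¹ (u a)` with `u = q⁻¹ q_!`, and symmetrically for `b`. Cutting
each side of the rectangle by the hull of the other therefore loses nothing. -/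
theorem kernelPair_restrict_rect (hq : OpenMap q) (a b : Opens X) :
    (kernelPair q).restrict (rect a b) =
      (kernelPair q).restrict (rect (a ⊓ fiberHull q b) (fiberHull q a ⊓ b)) := by
  have h : preimage (source (kernelPair q)) a ≤
      preimage (target (kernelPair q)) (fiberHull q a) :=
    (OrderHomClass.mono _ (le_fiberHull hq a)).trans
      (source_preimage_eq_target_preimage q _).le
  have h' : preimage (target (kernelPair q)) b ≤
      preimage (source (kernelPair q)) (fiberHull q b) :=
    (OrderHomClass.mono _ (le_fiberHull hq b)).trans
      (source_preimage_eq_target_preimage q _).ge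
  rw [restrict_rect, restrict_rect, map_inf, map_inf]
  exact le_antisymm (le_inf (le_inf inf_le_left (inf_le_right.trans h'))
    (le_inf (inf_le_left.trans h) inf_le_right)) (inf_le_inf inf_le_left inf_le_right)

/-- The kernel pair of an open map is the relation induced by the cones `q⁻¹ q_!`. -/
theorem kernelPair_eq_inducedRel (hq : OpenMap q) :
    kernelPair q = inducedRel (fiberHull q) (fiberHull q) := by
  apply le_antisymm
  -- `K` must identify rectangles with the same reduced cones: both equal their reduced forms in
  -- `K`, and the hypothesis says that these coincide side by side.
  · refine le_saturated_of_restrict_eq (kernelPair q) ?_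
    rintro _ _ ⟨a, b, c, d, rfl, rfl, h⟩
    rw [kernelPair_restrict_rect hq a b, kernelPair_restrict_rect hq c d, h.1, h.2]
  -- Conversely, each generating pair of `K` is itself a pair of rectangles with the same reduced
  -- cones.
  · refine le_saturated_of_restrict_eq (inducedRel (fiberHull q) (fiberHull q)) ?_
    rintro _ _ ⟨V, rfl, rfl⟩
    refine restrict_inducedRel_eq ⟨?_, ?_⟩
    · rw [fiberHull_preimage hq, inf_top_eq]
    · rw [fiberHull_preimage hq, top_inf_eq, inf_comm]

end KernelPair

/-! ### From equality of relations to invertibility of the unit -/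

/-- Both relations are variables so that `subst` applies. In the intended use one side is built from
the cones of the other, and the equation cannot be eliminated directly. -/
theorem monotoneMap_id_of_eq {X : Locale.{u}} {R S : LocalicRel X} (h : R = S) :
    MonotoneMap (A := ⟨X, R⟩) (B := ⟨X, S⟩) (𝟙 X) := by
  subst h
  exact ⟨𝟙 _, by rw [prodMap_id, Category.id_comp, Category.comp_id]⟩

/-- An open cone relation is a fixed point as soon as it is induced by its own cones. -/
theorem isFixedPoint_of_eq (A : OpenConeLoc.{u})
    (h : A.obj.rel = inducedRel (upCone A.obj.rel) (downCone A.obj.rel)) : IsFixedPoint A := by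
  -- The candidate inverse of the unit. Both are carried by the identity of `X`, and morphisms are
  -- determined by their underlying locale maps, so only the monotonicity of `g` needs the
  -- hypothesis.
  let g : relOf (conicOf A) ⟶ A := ObjectProperty.homMk
    ⟨𝟙 A.obj.X, monotoneMap_id_of_eq (X := A.obj.X) h.symm⟩
  exact ⟨g, OpenConeLoc.hom_ext (Category.comp_id (𝟙 A.obj.X)),
    OpenConeLoc.hom_ext (Category.comp_id (𝟙 A.obj.X))⟩

end Localic

theorem mainTheorem7 {X Q : Locale.{u}} (q : X ⟶ Q) (hq : Localic.OpenMap q) :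
    ∃ h : Localic.HasOpenCones (Localic.kernelPair q),
      (∀ U : Localic.Opens X, Localic.upCone (Localic.kernelPair q) U =
        Localic.preimage q (Localic.directImage q U)) ∧
      (∀ U : Localic.Opens X, Localic.downCone (Localic.kernelPair q) U =
        Localic.preimage q (Localic.directImage q U)) ∧
      Localic.IsFixedPoint ⟨⟨X, Localic.kernelPair q⟩, h⟩ ∧
      Localic.kernelPair q = Localic.inducedRel (Localic.upCone (Localic.kernelPair q))
        (Localic.downCone (Localic.kernelPair q)) := by
  have hj := Localic.fiberHull_joinPreserving hq
  have hp := Localic.fiberHull_parallel hq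
  have hK := Localic.kernelPair_eq_inducedRel hq
  -- The cones of `K` are not computed from its source and target: they are read off from the
  -- presentation of `K` as an induced relation.
  have hu : Localic.upCone (Localic.kernelPair q) = Localic.fiberHull q := by
    rw [hK, Localic.upCone_inducedRel hj hj hp]
  have hd : Localic.downCone (Localic.kernelPair q) = Localic.fiberHull q := by
    rw [hK, Localic.downCone_inducedRel hj hj hp]
  have hR : Localic.kernelPair q = Localic.inducedRel (Localic.upCone (Localic.kernelPair q))
      (Localic.downCone (Localic.kernelPair q)) := by
    rw [hu, hd]
    exact hK
  refine ⟨?_, fun U => congrFun hu U, fun U => congrFun hd U,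
    Localic.isFixedPoint_of_eq _ hR, hR⟩
  -- Openness of the source and target of `K` likewise comes from the induced relation.
  rw [hK]
  exact Localic.inducedRel_hasOpenCones hj hj hp
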